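/- Let $0\le\varepsilon<1$, let $A$ be a unital $C^*$-algebra and let $H$ be a complex Hilbert space. For a linear map $\theta\colon A\to B(H)$ put $\|\theta\|_{cb}=\sup_{n\ge 1}\|\theta_n\|$, where $\theta_n\colon M_n(A)\to M_n(B(H))$, $\theta_n((a_{ij}))=(\theta(a_{ij}))$; the map $\theta$ is completely bounded if $\|\theta\|_{cb}<\infty$, completely positive if every $\theta_n$ is positive, and self-adjoint if $\theta(a^*)=\theta(a)^*$ for all $a\in A$. Let $\phi\colon A\to B(H)$ be a linear map that is self-adjoint, unital ($\phi(1)=1$) and completely bounded with $\|\phi\|_{cb}\le 1+\varepsilon$. Then there exists a unital completely positive linear map $\psi\colon A\to B(H)$ such that $$\|\phi-\psi\|_{cb}\le 3\sqrt{\varepsilon}.$$ -/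

import Mathlib

open scoped ENNReal CStarAlgebra

noncomputable section

namespace CompletelyBounded

variable {A B : Type*}
  [NonUnitalCStarAlgebra A] [PartialOrder A] [StarOrderedRing A]
  [NonUnitalCStarAlgebra B] [PartialOrder B] [StarOrderedRing B]

/-- The norm `‖φₙ‖` of the `n`-th amplification `φₙ : Mₙ(A) → Mₙ(B)`, `(aᵢⱼ) ↦ (φ(aᵢⱼ))`, of a
linear map between C⋆-algebras, as an element of `[0, ∞]` (it is `∞` when `φₙ` is unbounded).
The matrix algebras carry their C⋆-norms. -/
def ampNorm (φ : A →ₗ[ℂ] B) (n : ℕ) : ℝ≥0∞ :=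
  ⨆ (M : CStarMatrix (Fin n) (Fin n) A) (_ : ‖M‖ ≤ 1), ‖M.map φ‖ₑ

/-- The completely bounded norm `‖φ‖_cb = supₙ ‖φₙ‖`, as an element of `[0, ∞]`. -/
def cbNorm (φ : A →ₗ[ℂ] B) : ℝ≥0∞ :=
  ⨆ n : ℕ, ampNorm φ n

/-- A linear map between C⋆-algebras is completely bounded if its cb-norm is finite. -/
def IsCompletelyBounded (φ : A →ₗ[ℂ] B) : Prop :=
  cbNorm φ < ∞

/-- A linear map between C⋆-algebras is self-adjoint if it commutes with the involutions. -/
def IsSelfAdjointMap (φ : A →ₗ[ℂ] B) : Prop :=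
  ∀ a : A, φ (star a) = star (φ a)

end CompletelyBounded

end

/-! Put c = 1 + ε. The key is a decomposition 2φ = Φ₁ - Φ₂ with Φ₁, Φ₂ completely positive, Φ₁(1) =
(c + 1)·1 and hence Φ₂(1) = (c - 1)·1 = ε·1. Then ψ = Φ₁/(2 + ε) is unital and φ - ψ = (ε/2)ψ -
Φ₂/2. The amplifications of a completely positive map are controlled by its value at 1
(`CompletelyPositiveMap.norm_map_le`), so each term contributes at most ε/2. The resulting bound ε
is sharper than 3√ε.

To find Φ₁, fix a Hamel basis (bᵢ) of H. A map θ : A → B(H) becomes the functional u ↦ ∑ ⟪bᵢ, θ(uᵢⱼ)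
bⱼ⟫ on finitely supported matrices over A, and complete positivity becomes positivity on the
matrices (xᵢ⋆ xⱼ). On pairs (u, v) whose sum is a scalar matrix T, consider the real part of c ∑ Tᵢⱼ
⟪bᵢ, bⱼ⟫ + ∑ ⟪bᵢ, φ(uᵢⱼ - vᵢⱼ) bⱼ⟫. It is nonnegative on positive pairs: M, N ≥ 0 with M + N = T
force M - N = β⋆Dβ, where ‖D‖ ≤ 1, β is scalar and β⋆β is T up to a small perturbation
(`exists_sub_eq_conj`, `norm_form_sub_le`). The M. Riesz extension theorem extends this to all pairs
(`exists_functional`). Restricting to the two coordinates gives the functionals of Φ₁ and Φ₂ = Φ₁ -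
2φ. A GNS-style Cauchy–Schwarz estimate turns the first back into an operator-valued map
(`exists_eq_functional`). -/

noncomputable section

open scoped ComplexOrder InnerProductSpace

/-! ### Matrices over B(H) as operators on Hⁿ -/

namespace CStarMatrix

/-- The matrix `(xᵢ⋆ xⱼ)` is positive. -/
theorem nonneg_star_mul {n A : Type*} [Fintype n] [CStarAlgebra A] [PartialOrder A]
    [StarOrderedRing A] (x : n → A) :
    0 ≤ (ofMatrix <| Matrix.of fun i j ↦ star (x i) * x j : CStarMatrix n n A) := by
  classical
  cases isEmpty_or_nonempty n with
  | inl h => exact (CStarMatrix.ext fun i _ ↦ isEmptyElim i : (0 : CStarMatrix n n A) = _).le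
  | inr h =>
    obtain ⟨i₀⟩ := h
    let R : CStarMatrix n n A := ofMatrix <| Matrix.of fun i j ↦ if i = i₀ then x j else 0
    convert star_mul_self_nonneg R using 1
    ext i j
    simp [R, mul_apply, star_apply]

variable {n H : Type*} [Fintype n] [NormedAddCommGroup H] [InnerProductSpace ℂ H]

/-- The operator on `Hⁿ` defined by a matrix of operators on `H`. -/
def toOp (N : CStarMatrix n n (H →L[ℂ] H)) :
    PiLp 2 (fun _ : n ↦ H) →L[ℂ] PiLp 2 (fun _ : n ↦ H) :=
  (PiLp.continuousLinearEquiv 2 ℂ (fun _ : n ↦ H)).symm.toContinuousLinearMap ∘L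
    (ContinuousLinearMap.pi fun i ↦ ∑ j, N i j ∘L (PiLp.proj 2 (fun _ : n ↦ H) j))

@[simp]
theorem toOp_apply (N : CStarMatrix n n (H →L[ℂ] H)) (x : PiLp 2 (fun _ : n ↦ H)) (i : n) :
    toOp N x i = ∑ j, N i j (x j) := by
  simp [toOp]

theorem inner_toOp (N : CStarMatrix n n (H →L[ℂ] H)) (x y : PiLp 2 (fun _ : n ↦ H)) :
    ⟪x, toOp N y⟫_ℂ = ∑ i, ∑ j, ⟪x i, N i j (y j)⟫_ℂ := by
  simp [PiLp.inner_apply, inner_sum]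

variable [CompleteSpace H]

variable (n H) in
/-- `Mₙ(B(H)) ≃ B(Hⁿ)`. -/
def toOpEquiv : CStarMatrix n n (H →L[ℂ] H) ≃⋆ₐ[ℂ]
    (PiLp 2 (fun _ : n ↦ H) →L[ℂ] PiLp 2 (fun _ : n ↦ H)) :=
  StarAlgEquiv.ofBijective
    ({ toFun := toOp
       map_smul' := fun c M ↦ by ext x i; simp [Finset.smul_sum]
       map_zero' := by ext x i; simp
       map_add' := fun M N ↦ by ext x i; simp [Finset.sum_add_distrib]
       map_mul' := fun M N ↦ by
        ext x i
        simp only [toOp_apply, mul_apply, _root_.sum_apply,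
          mul_apply_eq_comp, map_sum]
        rw [Finset.sum_comm]
       map_star' := fun M ↦ by
        rw [ContinuousLinearMap.star_eq_adjoint, ContinuousLinearMap.eq_adjoint_iff]
        intro x y
        rw [← inner_conj_symm, inner_toOp, inner_toOp, map_sum, Finset.sum_comm]
        simp only [map_sum, star_apply, ContinuousLinearMap.star_eq_adjoint, inner_conj_symm,
          ContinuousLinearMap.adjoint_inner_left] } :
      CStarMatrix n n (H →L[ℂ] H) →⋆ₙₐ[ℂ] _) (by
    classical
    refine ⟨fun M N h ↦ ?_, fun T ↦ ?_⟩
    · ext i j v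
      have := congr($h (WithLp.toLp 2 (Pi.single j v)) i)
      simpa [Pi.single_apply, apply_ite] using this
    · refine ⟨ofMatrix <| Matrix.of fun i j ↦ PiLp.proj 2 (fun _ : n ↦ H) i ∘L T ∘L
        (PiLp.continuousLinearEquiv 2 ℂ (fun _ : n ↦ H)).symm.toContinuousLinearMap ∘L
        ContinuousLinearMap.single ℂ (fun _ ↦ H) j, ?_⟩
      ext x i
      change toOp _ x i = _
      have hx : x = ∑ j, WithLp.toLp 2 (Pi.single j (x j)) := by
        ext k
        simp
      conv_rhs => rw [hx]
      simp)

@[simp]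
theorem toOpEquiv_apply (N : CStarMatrix n n (H →L[ℂ] H)) : toOpEquiv n H N = toOp N := rfl

theorem norm_toOp (N : CStarMatrix n n (H →L[ℂ] H)) : ‖toOp N‖ = ‖N‖ :=
  NonUnitalStarAlgHom.norm_map (toOpEquiv n H) (toOpEquiv n H).injective N

theorem nonneg_iff_toOp (N : CStarMatrix n n (H →L[ℂ] H)) : 0 ≤ N ↔ 0 ≤ toOp N :=
  ⟨fun h ↦ map_nonneg (toOpEquiv n H) h, fun h ↦ by
    have := map_nonneg (toOpEquiv n H).symm h
    rwa [← toOpEquiv_apply, StarAlgEquiv.symm_apply_apply] at this⟩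

theorem nonneg_iff_inner (N : CStarMatrix n n (H →L[ℂ] H)) :
    0 ≤ N ↔ ∀ x : n → H, 0 ≤ ∑ i, ∑ j, ⟪x i, N i j (x j)⟫_ℂ := by
  rw [nonneg_iff_toOp, ContinuousLinearMap.nonneg_iff_isPositive]
  constructor
  · intro h x
    have := h.inner_nonneg_right (WithLp.toLp 2 x)
    rwa [inner_toOp] at this
  · intro h
    rw [ContinuousLinearMap.isPositive_iff_complex]
    intro x
    have := h x
    rw [← inner_toOp, Complex.nonneg_iff] at this
    have e : ⟪toOp N x, x⟫_ℂ = ⟪x, toOp N x⟫_ℂ := by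
      rw [← inner_conj_symm]
      exact Complex.conj_eq_iff_im.2 this.2.symm
    rw [e]
    exact ⟨Complex.ext rfl this.2, this.1⟩

theorem norm_sum_inner_le (N : CStarMatrix n n (H →L[ℂ] H)) (x : n → H) :
    ‖∑ i, ∑ j, ⟪x i, N i j (x j)⟫_ℂ‖ ≤ ‖N‖ * ∑ i, ‖x i‖ ^ 2 := by
  set y : PiLp 2 (fun _ : n ↦ H) := WithLp.toLp 2 x
  have h : ∑ i, ‖x i‖ ^ 2 = ‖y‖ * ‖y‖ := by
    rw [← sq, PiLp.norm_sq_eq_of_L2]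
  calc _ = ‖⟪y, toOp N y⟫_ℂ‖ := by rw [inner_toOp]
    _ ≤ ‖y‖ * ‖toOp N y‖ := norm_inner_le_norm _ _
    _ ≤ ‖y‖ * (‖toOp N‖ * ‖y‖) := by gcongr; exact (toOp N).le_opNorm y
    _ = _ := by rw [norm_toOp, h]; ring

end CStarMatrix
end

/-! ### Order and norm estimates in C⋆-algebras -/

noncomputable section

open scoped ComplexOrder InnerProductSpace

namespace CStarAlgebra

variable {R S : Type*} [CStarAlgebra R] [PartialOrder R] [StarOrderedRing R]
  [CStarAlgebra S] [PartialOrder S] [StarOrderedRing S]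

theorem norm_le_one_of_neg_one_le_of_le_one {a : R} (ha : IsSelfAdjoint a) (h₁ : -1 ≤ a)
    (h₂ : a ≤ 1) : ‖a‖ ≤ 1 := by
  rw [← cfc_id ℝ a]
  refine norm_cfc_le zero_le_one fun x hx ↦ ?_
  rw [id, Real.norm_eq_abs, abs_le]
  constructor
  · exact (algebraMap_le_iff_le_spectrum (r := (-1 : ℝ)) ha).1 (by simpa using h₁) x hx
  · exact (le_algebraMap_iff_spectrum_le (r := (1 : ℝ)) ha).1 (by simpa using h₂) x hx

/-- Compressing T by T⁻ gives -(T⁻)³, whose image is both nonnegative and nonpositive; injectivity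
then kills (T⁻)³, hence T⁻. -/
theorem nonneg_of_map_nonneg (π : S →⋆ₐ[ℂ] R) (hπ : Function.Injective π) {T : S}
    (hT : 0 ≤ π T) : 0 ≤ T := by
  have hsa : IsSelfAdjoint T := hπ (by rw [map_star]; exact (IsSelfAdjoint.of_nonneg hT).star_eq)
  have hneg : T⁻ = 0 := by
    have hs : IsSelfAdjoint T⁻ := .of_nonneg (CFC.negPart_nonneg T)
    have h₁ : 0 ≤ π T⁻ * π T * π T⁻ := (hs.map π).conjugate_nonneg hT
    have h₂ : T⁻ * T * T⁻ = -(T⁻ * T⁻ * T⁻) := by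
      nth_rw 2 [← CFC.posPart_sub_negPart T hsa]
      rw [mul_sub, CFC.negPart_mul_posPart, zero_sub, neg_mul]
    have h₃ : 0 ≤ T⁻ * T⁻ * T⁻ := hs.conjugate_nonneg (CFC.negPart_nonneg T)
    rw [← map_mul, ← map_mul, h₂, map_neg, Left.nonneg_neg_iff] at h₁
    have h₄ : T⁻ * T⁻ * T⁻ = 0 :=
      hπ (by rw [map_zero]; exact le_antisymm h₁ (map_nonneg π h₃))
    have h₅ : star (T⁻ * T⁻) * (T⁻ * T⁻) = 0 := by
      rw [star_mul, hs.star_eq, ← mul_assoc, h₄, zero_mul]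
    rw [CStarRing.star_mul_self_eq_zero_iff] at h₅
    rwa [← CStarRing.star_mul_self_eq_zero_iff, hs.star_eq]
  rw [← CFC.posPart_sub_negPart T hsa, hneg, sub_zero]
  exact CFC.posPart_nonneg T

theorem exists_one_sub_eq_star_mul_self {a : R} (ha : ‖a‖ ≤ 1) :
    ∃ y, 1 - star a * a = star y * y := by
  refine CStarAlgebra.nonneg_iff_eq_star_mul_self.1 (sub_nonneg.2 ?_)
  refine CStarAlgebra.star_mul_le_algebraMap_norm_sq.trans ?_
  rw [← map_one (algebraMap ℝ R)]
  exact algebraMap_mono _ (pow_le_one₀ (norm_nonneg _) ha)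

/-- If `M` and `N` are positive with sum in the image of `π`, then `M - N` is a contraction
conjugated by a square root of (a perturbation of) that sum. -/
theorem exists_sub_eq_conj (π : S →⋆ₐ[ℂ] R) (hπ : Function.Injective π) {M N : R} {T : S}
    (hM : 0 ≤ M) (hN : 0 ≤ N) (h : M + N = π T) {δ : ℝ} (hδ : 0 < δ) :
    ∃ (b : S) (D : R), T + (δ : ℂ) • 1 = star b * b ∧ M - N = star (π b) * D * π b ∧
      ‖D‖ ≤ 1 := by
  have hT : 0 ≤ T := nonneg_of_map_nonneg π hπ (h ▸ add_nonneg hM hN)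
  -- T may be singular; the shift by δ makes b invertible, so that D can be obtained by conjugating
  -- M - N with its inverse.
  have hpos : IsStrictlyPositive (T + algebraMap ℝ S δ) :=
    (isStrictlyPositive_algebraMap hδ).nonneg_add hT
  obtain ⟨b, hb, hTb⟩ := CStarAlgebra.isStrictlyPositive_iff_eq_star_mul_self.1 hpos
  obtain ⟨u, rfl⟩ := hb
  set v : R := π (↑u⁻¹ : S) with hv
  have huv : π u * v = 1 := by rw [hv, ← map_mul]; simp
  have huv' : star v * star (π u) = 1 := by rw [← star_mul, huv, star_one]
  have hsa : IsSelfAdjoint (M - N) := (IsSelfAdjoint.of_nonneg hM).sub (.of_nonneg hN)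
  have hle : M + N ≤ star (π u) * π u := by
    rw [h, ← map_star, ← map_mul, ← hTb, map_add]
    refine le_add_of_nonneg_right (map_nonneg π ?_)
    exact (isStrictlyPositive_algebraMap hδ).nonneg
  have hone : star v * (star (π u) * π u) * v = 1 := by
    calc _ = (star v * star (π u)) * (π u * v) := by noncomm_ring
      _ = 1 := by rw [huv, huv', one_mul]
  refine ⟨u, star v * (M - N) * v, ?_, ?_, ?_⟩
  · rw [← hTb, Algebra.algebraMap_eq_smul_one, Complex.coe_smul]
  · have e₁ : v * π u = 1 := by rw [hv, ← map_mul]; simp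
    have e₂ : star (π u) * star v = 1 := by rw [← star_mul, e₁, star_one]
    calc M - N = (star (π u) * star v) * (M - N) * (v * π u) := by rw [e₁, e₂]; simp
      _ = _ := by noncomm_ring
  · refine norm_le_one_of_neg_one_le_of_le_one (hsa.conjugate' v) ?_ ?_
    · rw [neg_le, ← hone, ← neg_mul, ← mul_neg]
      refine star_left_conjugate_le_conjugate ?_ v
      refine le_trans ?_ hle
      rw [neg_sub, sub_eq_add_neg, add_comm]
      exact add_le_add_left ((neg_nonpos.2 hM).trans hM) _
    · rw [← hone]
      refine star_left_conjugate_le_conjugate ?_ v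
      refine le_trans ?_ hle
      rw [sub_eq_add_neg]
      exact add_le_add_right ((neg_nonpos.2 hN).trans hN) _

end CStarAlgebra

section
variable {n A H : Type*} [Fintype n] [CStarAlgebra A] [PartialOrder A] [StarOrderedRing A]
  [NormedAddCommGroup H] [InnerProductSpace ℂ H] [CompleteSpace H]

/-- The block matrix [1 M; M⋆ 1] is X⋆X plus the corner 1 - M⋆M, where X has first row (1 M) and
second row zero. -/
theorem CStarMatrix.exists_block_nonneg [DecidableEq n] {M : CStarMatrix n n A} (hM : ‖M‖ ≤ 1) :
    ∃ G : CStarMatrix (n ⊕ n) (n ⊕ n) A, 0 ≤ G ∧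
      (∀ i j, G (.inl i) (.inl j) = (1 : CStarMatrix n n A) i j) ∧
      (∀ i j, G (.inl i) (.inr j) = M i j) ∧
      (∀ i j, G (.inr i) (.inl j) = star (M j i)) ∧
      (∀ i j, G (.inr i) (.inr j) = (1 : CStarMatrix n n A) i j) := by
  obtain ⟨Y, hY⟩ := CStarAlgebra.exists_one_sub_eq_star_mul_self hM
  let X' : CStarMatrix (n ⊕ n) (n ⊕ n) A := ofMatrix (Matrix.fromBlocks 1 (ofMatrix.symm M) 0 0)
  let Y' : CStarMatrix (n ⊕ n) (n ⊕ n) A := ofMatrix (Matrix.fromBlocks 0 0 0 (ofMatrix.symm Y))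
  refine ⟨star X' * X' + star Y' * Y', add_nonneg (star_mul_self_nonneg _)
    (star_mul_self_nonneg _), fun i j ↦ ?_, fun i j ↦ ?_, fun i j ↦ ?_, fun i j ↦ ?_⟩
  · rcases eq_or_ne i j with rfl | h
    · simp [X', Y', mul_apply, star_apply, Matrix.one_apply, apply_ite]
    · simp [X', Y', mul_apply, star_apply, Matrix.one_apply, h, h.symm, apply_ite]
  · simp [X', Y', mul_apply, star_apply, Matrix.one_apply, apply_ite]
  · simp [X', Y', mul_apply, star_apply, Matrix.one_apply]
  · have : (1 : CStarMatrix n n A) i j = (star M * M + star Y * Y) i j := by rw [← hY]; simp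
    rw [this]
    simp [X', Y', mul_apply, star_apply]

/-- Positivity of the image of [1 M; M⋆ 1], with diagonal blocks k·1, bounds the off-diagonal block
by k. -/
theorem CompletelyPositiveMap.norm_map_le (θ : A →CP (H →L[ℂ] H)) {k : ℝ} (hk : 0 ≤ k)
    (hθ : θ 1 = (k : ℂ) • 1) {M : CStarMatrix n n A} (hM : ‖M‖ ≤ 1) : ‖M.map θ‖ ≤ k := by
  classical
  obtain ⟨G, hG, h₁, h₂, h₃, h₄⟩ := CStarMatrix.exists_block_nonneg hM
  have key (x y : PiLp 2 (fun _ : n ↦ H)) :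
      0 ≤ k * (‖x‖ ^ 2 + ‖y‖ ^ 2) + 2 * (⟪x, (M.map θ).toOp y⟫_ℂ).re := by
    have := (CStarMatrix.nonneg_iff_inner _).1 (θ.map_cstarMatrix_nonneg G hG) (Sum.elim x y)
    have hstar (a : A) (v w : H) : ⟪v, θ (star a) w⟫_ℂ = starRingEnd ℂ ⟪w, θ a v⟫_ℂ := by
      rw [map_star, ContinuousLinearMap.star_eq_adjoint, ContinuousLinearMap.adjoint_inner_right,
        inner_conj_symm]
    have hone (x : PiLp 2 (fun _ : n ↦ H)) :
        ∑ i, ∑ j, ⟪x i, θ ((1 : CStarMatrix n n A) i j) (x j)⟫_ℂ = ((k * ‖x‖ ^ 2 : ℝ) : ℂ) := by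
      have (i j : n) : ⟪x i, θ ((1 : CStarMatrix n n A) i j) (x j)⟫_ℂ =
          if i = j then (k : ℂ) * ⟪x i, x i⟫_ℂ else 0 := by
        split_ifs with h
        · subst h
          simp [hθ]
        · simp [CStarMatrix.one_apply_ne h]
      simp only [this, Finset.sum_ite_eq, Finset.mem_univ, if_true, ← Finset.mul_sum,
        inner_self_eq_norm_sq_to_K]
      rw [PiLp.norm_sq_eq_of_L2]
      simp
    simp only [Fintype.sum_sum_type, Sum.elim_inl, Sum.elim_inr, CStarMatrix.map_apply, h₁, h₂,
      h₃, h₄, Finset.sum_add_distrib, hstar, hone] at this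
    rw [Finset.sum_comm (f := fun i j ↦ starRingEnd ℂ _)] at this
    simp only [← map_sum] at this
    rw [CStarMatrix.inner_toOp]
    simp only [CStarMatrix.map_apply]
    have := (Complex.nonneg_iff.1 this).1
    simp only [Complex.add_re, Complex.ofReal_re, Complex.conj_re] at this
    linarith
  rw [← CStarMatrix.norm_toOp]
  refine ContinuousLinearMap.opNorm_le_bound _ hk fun y ↦ ?_
  set T := (M.map θ).toOp
  by_cases hT : ‖T y‖ = 0
  · rw [hT]; positivity
  have hT' : 0 < ‖T y‖ := lt_of_le_of_ne (norm_nonneg _) (Ne.symm hT)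
  have hy : 0 < ‖y‖ := norm_pos_iff.2 (by rintro rfl; simp at hT)
  -- This vector has the norm of y and points opposite to T y, which makes `key` sharpest.
  have h := key (-((‖y‖ / ‖T y‖ : ℝ) : ℂ) • T y) y
  rw [inner_smul_left, inner_self_eq_norm_sq_to_K, norm_smul, norm_neg, Complex.norm_real,
    Real.norm_of_nonneg (by positivity), div_mul_cancel₀ _ hT] at h
  have e : (starRingEnd ℂ (-((‖y‖ / ‖T y‖ : ℝ) : ℂ)) * (‖T y‖ : ℂ) ^ 2).re = - (‖y‖ * ‖T y‖) := by
    have : (starRingEnd ℂ (-((‖y‖ / ‖T y‖ : ℝ) : ℂ)) * (‖T y‖ : ℂ) ^ 2) =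
        ((- (‖y‖ / ‖T y‖) * ‖T y‖ ^ 2 : ℝ) : ℂ) := by simp
    rw [this, Complex.ofReal_re]
    field_simp
  erw [e] at h
  nlinarith

end
end

/-! ### Scalar matrices and the basic estimate for a bounded map -/

noncomputable section

open scoped ComplexOrder InnerProductSpace

namespace CStarMatrix

variable {n A H : Type*} [Fintype n] [CStarAlgebra A] [NormedAddCommGroup H]
  [InnerProductSpace ℂ H]

variable (n A) in
/-- The inclusion of the scalar matrices in `Mₙ(A)`. -/
def ofScalars [DecidableEq n] : CStarMatrix n n ℂ →⋆ₐ[ℂ] CStarMatrix n n A where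
  toFun M := M.map (algebraMap ℂ A)
  map_one' := by
    ext i j
    rcases eq_or_ne i j with rfl | h
    · simp
    · simp [h]
  map_mul' M N := by ext i j; simp [mul_apply]
  map_zero' := by ext i j; simp
  map_add' M N := by ext i j; simp
  commutes' r := by
    ext i j
    rcases eq_or_ne i j with rfl | h
    · simp [algebraMap_apply]
    · simp [algebraMap_apply, h]
  map_star' M := by ext i j; simpa [star_apply] using algebraMap_star_comm (M j i)

@[simp]
theorem ofScalars_apply [DecidableEq n] (M : CStarMatrix n n ℂ) (i j : n) :
    ofScalars n A M i j = algebraMap ℂ A (M i j) := rfl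

theorem ofScalars_injective [DecidableEq n] [Nontrivial A] :
    Function.Injective (ofScalars n A) := fun M N h ↦ by
  ext i j
  exact FaithfulSMul.algebraMap_injective ℂ A congr($h i j)

/-- The form `∑ ⟪ξᵢ, θ(Mᵢⱼ) ξⱼ⟫` associated with a map `θ : A → B(H)`. -/
def form (θ : A →ₗ[ℂ] (H →L[ℂ] H)) (ξ : n → H) (M : CStarMatrix n n A) : ℂ :=
  ∑ i, ∑ j, ⟪ξ i, θ (M i j) (ξ j)⟫_ℂ

/-- By linearity of θ, scalar coefficients pass through it and can be moved onto the vectors; only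
the bound on D is then needed. -/
theorem form_conj [DecidableEq n] (θ : A →ₗ[ℂ] (H →L[ℂ] H)) (ξ : n → H)
    (b : CStarMatrix n n ℂ) (D : CStarMatrix n n A) :
    form θ ξ (star (ofScalars n A b) * D * ofScalars n A b) =
      form θ (fun k ↦ ∑ i, b k i • ξ i) D := by
  have h₁ (i j : n) : (star (ofScalars n A b) * D * ofScalars n A b) i j =
      ∑ l, ∑ k, (starRingEnd ℂ (b k i) * b l j) • D k l := by
    simp only [mul_apply, star_apply, ofScalars_apply, Finset.sum_mul]
    refine Finset.sum_congr rfl fun l _ ↦ Finset.sum_congr rfl fun k _ ↦ ?_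
    rw [← algebraMap_star_comm, mul_assoc, ← Algebra.commutes, ← mul_assoc, ← map_mul,
      Algebra.smul_def]
    rfl
  simp only [form, h₁, map_sum, map_smul, _root_.sum_apply, _root_.smul_apply, inner_sum,
    sum_inner, inner_smul_left, inner_smul_right]
  calc _ = ∑ i, ∑ l, ∑ j, ∑ k, starRingEnd ℂ (b k i) * b l j * ⟪ξ i, θ (D k l) (ξ j)⟫_ℂ :=
        Finset.sum_congr rfl fun i _ ↦ Finset.sum_comm
    _ = ∑ i, ∑ l, ∑ k, ∑ j, starRingEnd ℂ (b k i) * b l j * ⟪ξ i, θ (D k l) (ξ j)⟫_ℂ :=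
        Finset.sum_congr rfl fun i _ ↦ Finset.sum_congr rfl fun l _ ↦ Finset.sum_comm
    _ = ∑ i, ∑ k, ∑ l, ∑ j, starRingEnd ℂ (b k i) * b l j * ⟪ξ i, θ (D k l) (ξ j)⟫_ℂ :=
        Finset.sum_congr rfl fun i _ ↦ Finset.sum_comm
    _ = ∑ k, ∑ i, ∑ l, ∑ j, starRingEnd ℂ (b k i) * b l j * ⟪ξ i, θ (D k l) (ξ j)⟫_ℂ :=
        Finset.sum_comm
    _ = ∑ k, ∑ l, ∑ i, ∑ j, starRingEnd ℂ (b k i) * b l j * ⟪ξ i, θ (D k l) (ξ j)⟫_ℂ :=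
        Finset.sum_congr rfl fun k _ ↦ Finset.sum_comm
    _ = ∑ k, ∑ l, ∑ j, ∑ i, starRingEnd ℂ (b k i) * b l j * ⟪ξ i, θ (D k l) (ξ j)⟫_ℂ :=
        Finset.sum_congr rfl fun k _ ↦ Finset.sum_congr rfl fun l _ ↦ Finset.sum_comm
    _ = _ := by
      simp only [Finset.mul_sum]
      refine Finset.sum_congr rfl fun k _ ↦ Finset.sum_congr rfl fun l _ ↦
        Finset.sum_congr rfl fun j _ ↦ Finset.sum_congr rfl fun i _ ↦ ?_
      ring

theorem sum_norm_sq_eq (ξ : n → H) (b : CStarMatrix n n ℂ) :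
    ((∑ k, ‖∑ i, b k i • ξ i‖ ^ 2 : ℝ) : ℂ) =
      ∑ i, ∑ j, (star b * b) i j * ⟪ξ i, ξ j⟫_ℂ := by
  have (k : n) : ((‖∑ i, b k i • ξ i‖ ^ 2 : ℝ) : ℂ) =
      ∑ i, ∑ j, starRingEnd ℂ (b k i) * b k j * ⟪ξ i, ξ j⟫_ℂ := by
    rw [Complex.ofReal_pow]
    refine (inner_self_eq_norm_sq_to_K (𝕜 := ℂ) (∑ i, b k i • ξ i)).symm.trans ?_
    simp only [inner_sum, sum_inner, inner_smul_left, inner_smul_right, Finset.mul_sum]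
    rw [Finset.sum_comm]
    refine Finset.sum_congr rfl fun k _ ↦ Finset.sum_congr rfl fun l _ ↦ ?_
    ring
  rw [Complex.ofReal_sum]
  simp only [this, mul_apply, star_apply, Finset.sum_mul]
  rw [Finset.sum_comm]
  refine Finset.sum_congr rfl fun i _ ↦ ?_
  rw [Finset.sum_comm]
  rfl

variable [PartialOrder A] [StarOrderedRing A] [CompleteSpace H]

/-- If `M` and `N` are positive with sum the scalar matrix `T`, then a completely bounded map
evaluated at `M - N` is controlled by `T`. -/
theorem norm_form_sub_le [Nontrivial A] [DecidableEq n] {θ : A →ₗ[ℂ] (H →L[ℂ] H)} {c : ℝ}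
    (hθ : ∀ M : CStarMatrix n n A, ‖M‖ ≤ 1 → ‖M.map θ‖ ≤ c) {M N : CStarMatrix n n A}
    {T : CStarMatrix n n ℂ} (hM : 0 ≤ M) (hN : 0 ≤ N) (h : M + N = ofScalars n A T)
    (ξ : n → H) :
    ‖form θ ξ (M - N)‖ ≤ c * (∑ i, ∑ j, T i j * ⟪ξ i, ξ j⟫_ℂ).re := by
  have hc : 0 ≤ c := (norm_nonneg _).trans (hθ 0 (by simp))
  have key (δ : ℝ) (hδ : 0 < δ) : ‖form θ ξ (M - N)‖ ≤
      c * (∑ i, ∑ j, T i j * ⟪ξ i, ξ j⟫_ℂ).re + δ * (c * ∑ i, ‖ξ i‖ ^ 2) := by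
    obtain ⟨b, D, hb, hD, hD1⟩ :=
      CStarAlgebra.exists_sub_eq_conj (ofScalars n A) ofScalars_injective hM hN h hδ
    rw [hD, form_conj]
    refine (norm_sum_inner_le (D.map θ) _).trans ?_
    have e := sum_norm_sq_eq ξ b
    have e₂ : ∑ i, ∑ j, (star b * b) i j * ⟪ξ i, ξ j⟫_ℂ =
        ∑ i, ∑ j, T i j * ⟪ξ i, ξ j⟫_ℂ + ((δ * ∑ i, ‖ξ i‖ ^ 2 : ℝ) : ℂ) := by
      rw [← hb]
      simp only [add_apply, add_mul, Finset.sum_add_distrib]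
      congr 1
      simp [one_apply, Finset.mul_sum]
    have e₃ := congr(Complex.re $(e.trans e₂))
    rw [Complex.ofReal_re, Complex.add_re, Complex.ofReal_re] at e₃
    rw [e₃]
    calc _ ≤ c * ((∑ i, ∑ j, T i j * ⟪ξ i, ξ j⟫_ℂ).re + δ * ∑ i, ‖ξ i‖ ^ 2) := by
          refine mul_le_mul_of_nonneg_right (hθ D hD1) ?_
          rw [← e₃]
          positivity
      _ = _ := by ring
  set C := c * ∑ i, ‖ξ i‖ ^ 2 with hC
  have hC0 : 0 ≤ C := by positivity
  refine le_of_forall_pos_le_add fun ε hε ↦ ?_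
  -- This δ costs at most ε; the +1 in the denominator covers C = 0.
  refine (key (ε / (C + 1)) (by positivity)).trans ?_
  gcongr
  rw [div_mul_eq_mul_div, div_le_iff₀ (by positivity)]
  nlinarith

end CStarMatrix
end

/-! ### Finitely supported matrices and their positive cone -/

noncomputable section

open scoped ComplexOrder InnerProductSpace

theorem CStarAlgebra.real_smul_nonneg {R : Type*} [CStarAlgebra R] [PartialOrder R]
    [StarOrderedRing R] {r : ℝ} {a : R} (hr : 0 ≤ r) (ha : 0 ≤ a) : 0 ≤ (r : ℂ) • a := by
  rw [Complex.coe_smul]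
  exact smul_nonneg hr ha

namespace CompletelyBounded

open CStarMatrix

variable {ι A H : Type*} [CStarAlgebra A] [NormedAddCommGroup H] [InnerProductSpace ℂ H]

/-- The finitely supported matrix `(xᵢ⋆ yⱼ)`. -/
def sesq : (ι →₀ A) →ₗ⋆[ℂ] (ι →₀ A) →ₗ[ℂ] ((ι × ι) →₀ A) :=
  LinearMap.mk₂'ₛₗ (starRingEnd ℂ) (RingHom.id ℂ)
    (fun x y ↦ Finsupp.onFinset (x.support ×ˢ y.support) (fun p ↦ star (x p.1) * y p.2)
      fun p hp ↦ by
        rw [Finset.mem_product, Finsupp.mem_support_iff, Finsupp.mem_support_iff]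
        constructor <;> (intro h; simp [h] at hp))
    (fun x y z ↦ by ext; simp [add_mul]) (fun c x y ↦ by ext; simp)
    (fun x y z ↦ by ext; simp [mul_add]) (fun c x y ↦ by ext; simp)

@[simp]
theorem sesq_apply (x y : ι →₀ A) (p : ι × ι) : sesq x y p = star (x p.1) * y p.2 := rfl

theorem sesq_single_single (i j : ι) (x y : A) :
    sesq (Finsupp.single i x) (Finsupp.single j y) = Finsupp.single (i, j) (star x * y) := by
  classical
  ext ⟨k, l⟩
  simp only [sesq_apply, Finsupp.single_apply, Prod.mk.injEq]
  split_ifs <;> simp_all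

/-- The `s × s` corner of a finitely supported matrix. -/
def compress (s : Finset ι) : ((ι × ι) →₀ A) →ₗ[ℂ] CStarMatrix s s A where
  toFun u := ofMatrix <| Matrix.of fun i j ↦ u (i, j)
  map_add' _ _ := rfl
  map_smul' _ _ := rfl

@[simp]
theorem compress_apply (s : Finset ι) (u : (ι × ι) →₀ A) (i j : s) :
    compress s u i j = u (i, j) := rfl

theorem star_compress_sesq (s : Finset ι) (x : ι →₀ A) :
    star (compress s (sesq x x)) = compress s (sesq x x) := by
  ext i j
  simp [star_apply]

theorem star_compress_single (s : Finset ι) (i j : ι) (a : A) :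
    star (compress s (Finsupp.single (i, j) a)) = compress s (Finsupp.single (j, i) (star a)) := by
  classical
  ext k l
  simp only [star_apply, compress_apply, Finsupp.single_apply, Prod.mk.injEq, apply_ite star,
    star_zero, and_comm]

/-- The inclusion of finitely supported scalar matrices. -/
def scalars (ι A : Type*) [CStarAlgebra A] : ((ι × ι) →₀ ℂ) →ₗ[ℂ] ((ι × ι) →₀ A) :=
  Finsupp.mapRange.linearMap (Algebra.linearMap ℂ A)

/-- The functional `u ↦ ∑ ⟪bᵢ, θ(uᵢⱼ) bⱼ⟫`. -/
def functional (b : ι → H) (θ : A →ₗ[ℂ] (H →L[ℂ] H)) : ((ι × ι) →₀ A) →ₗ[ℂ] ℂ :=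
  Finsupp.lsum ℂ fun p ↦ (innerSL ℂ (b p.1)).toLinearMap ∘ₗ
    (ContinuousLinearMap.apply ℂ H (b p.2)).toLinearMap ∘ₗ θ

@[simp]
theorem functional_single (b : ι → H) (θ : A →ₗ[ℂ] (H →L[ℂ] H)) (p : ι × ι) (a : A) :
    functional b θ (Finsupp.single p a) = ⟪b p.1, θ a (b p.2)⟫_ℂ := by
  simp [functional]

theorem functional_eq_form (b : ι → H) (θ : A →ₗ[ℂ] (H →L[ℂ] H)) {s : Finset ι}
    {u : (ι × ι) →₀ A} (hu : u.support ⊆ s ×ˢ s) :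
    functional b θ u = form θ (fun i : s ↦ b i) (compress s u) := by
  rw [functional, Finsupp.lsum_apply, Finsupp.sum_of_support_subset _ hu _ (by simp),
    Finset.sum_product, form, ← Finset.sum_coe_sort s]
  refine Finset.sum_congr rfl fun i _ ↦ ?_
  rw [← Finset.sum_coe_sort s]
  rfl

theorem exists_support_subset (u : (ι × ι) →₀ A) : ∃ s : Finset ι, u.support ⊆ s ×ˢ s := by
  classical
  refine ⟨u.support.image Prod.fst ∪ u.support.image Prod.snd, fun p hp ↦ ?_⟩
  simp only [Finset.mem_product, Finset.mem_union, Finset.mem_image]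
  exact ⟨.inl ⟨p, hp, rfl⟩, .inr ⟨p, hp, rfl⟩⟩

variable [PartialOrder A] [StarOrderedRing A]

variable (ι A) in
/-- The cone of finitely supported matrices with positive real part. -/
def posCone : PointedCone ℝ ((ι × ι) →₀ A) where
  carrier := {u | ∀ s : Finset ι, 0 ≤ compress s u + star (compress s u)}
  zero_mem' s := by simp
  add_mem' {u v} hu hv s := by
    rw [map_add, star_add, add_add_add_comm]
    exact add_nonneg (hu s) (hv s)
  smul_mem' := by
    classical
    rintro ⟨r, hr⟩ u hu s
    have h : compress s ((⟨r, hr⟩ : {r : ℝ // 0 ≤ r}) • u) = (r : ℂ) • compress s u := by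
      ext i j
      exact (Complex.coe_smul r (u (i, j))).symm
    rw [h, star_smul, Complex.star_def, Complex.conj_ofReal, ← smul_add]
    exact CStarAlgebra.real_smul_nonneg hr (hu s)

theorem sesq_mem_posCone (x : ι →₀ A) : sesq x x ∈ posCone ι A := fun s ↦ by
  rw [star_compress_sesq]
  have : 0 ≤ compress s (sesq x x) := nonneg_star_mul fun i : s ↦ x i
  exact add_nonneg this this

/-- Skew-adjoint matrices have zero real part, so they and their negatives lie in the cone. -/
theorem single_sub_single_mem_posCone (i j : ι) (a : A) :
    Finsupp.single (i, j) a - Finsupp.single (j, i) (star a) ∈ posCone ι A := fun s ↦ by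
  simp [star_compress_single]

/-- This is the cofinality condition of the Riesz extension theorem: scalar matrices dominate
everything. -/
theorem exists_scalars_add_mem_posCone (u : (ι × ι) →₀ A) :
    ∃ T, scalars ι A T + u ∈ posCone ι A := by
  induction u using Finsupp.induction_linear with
  | zero => exact ⟨0, by simp⟩
  | add u v hu hv =>
    obtain ⟨S, hS⟩ := hu
    obtain ⟨T, hT⟩ := hv
    refine ⟨S + T, ?_⟩
    rw [map_add, add_add_add_comm]
    exact add_mem hS hT
  | single p a =>
    obtain ⟨i, j⟩ := p
    obtain ⟨d, hd⟩ : ∃ d : A, algebraMap ℝ A (‖a‖ ^ 2) - a * star a = star d * d :=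
      CStarAlgebra.nonneg_iff_eq_star_mul_self.1
        (sub_nonneg.2 CStarAlgebra.mul_star_le_algebraMap_norm_sq)
    refine ⟨Finsupp.single (i, i) ((‖a‖ ^ 2 : ℝ) : ℂ) + Finsupp.single (j, j) (1 / 4), ?_⟩
    -- The square of z has off-diagonal entries a/2 and a⋆/2 and diagonal entries aa⋆ and 1/4. The
    -- term from d completes aa⋆ to ‖a‖², and a skew-adjoint term turns the off-diagonal part into a
    -- alone.
    set z : ι →₀ A := Finsupp.single i (star a) + Finsupp.single j (algebraMap ℂ A (1 / 2))
    convert add_mem (add_mem (sesq_mem_posCone z) (sesq_mem_posCone (Finsupp.single i d)))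
      (single_sub_single_mem_posCone i j ((1 / 2 : ℂ) • a)) using 1
    have h : algebraMap ℂ A ((‖a‖ ^ 2 : ℝ) : ℂ) = algebraMap ℝ A (‖a‖ ^ 2) := by
      rw [IsScalarTower.algebraMap_apply ℝ ℂ A]; rfl
    simp only [z, map_add, LinearMap.add_apply, sesq_single_single, ← hd, scalars,
      Finsupp.mapRange.linearMap_apply, Finsupp.mapRange_single, Algebra.linearMap_apply, h,
      Finsupp.single_sub]
    have e₁ : star (star a) * algebraMap ℂ A (1 / 2) = (1 / 2 : ℂ) • a := by
      rw [star_star, ← Algebra.commutes, Algebra.smul_def]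
    have e₂ : star (algebraMap ℂ A (1 / 2)) * star a = star ((1 / 2 : ℂ) • a) := by
      rw [← e₁, star_mul, star_star]
    have e₃ : star (algebraMap ℂ A (1 / 2)) * algebraMap ℂ A (1 / 2) = algebraMap ℂ A (1 / 4) := by
      rw [← algebraMap_star_comm, ← map_mul]
      congr 1
      simp
      norm_num
    have e₄ : Finsupp.single (i, j) a = Finsupp.single (i, j) ((1 / 2 : ℂ) • a) +
        Finsupp.single (i, j) ((1 / 2 : ℂ) • a) := by
      rw [← Finsupp.single_add, ← add_smul]
      norm_num
    rw [e₁, e₂, e₃, e₄, star_star]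
    abel

theorem I_smul_sesq_mem_posCone (x : ι →₀ A) : Complex.I • sesq x x ∈ posCone ι A := fun s ↦ by
  rw [map_smul, star_smul, star_compress_sesq]
  simp

theorem neg_I_smul_sesq_mem_posCone (x : ι →₀ A) :
    -(Complex.I • sesq x x) ∈ posCone ι A := fun s ↦ by
  rw [map_neg, map_smul, star_neg, star_smul, star_compress_sesq]
  simp

/-- The imaginary part vanishes because both i·(xᵢ⋆ xⱼ) and its negative lie in the cone. -/
theorem extendRCLike_sesq_nonneg (G : ((ι × ι) →₀ A) →ₗ[ℝ] ℝ) (hG : ∀ u ∈ posCone ι A, 0 ≤ G u)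
    (x : ι →₀ A) : 0 ≤ Module.Dual.extendRCLike (𝕜 := ℂ) G (sesq x x) := by
  rw [Complex.nonneg_iff]
  constructor
  · have := Module.Dual.re_extendRCLike_apply (𝕜 := ℂ) G (sesq x x)
    exact (hG _ (sesq_mem_posCone x)).trans_eq this.symm
  · have := Module.Dual.im_extendRCLike_apply (𝕜 := ℂ) G (sesq x x)
    have h₁ := hG _ (I_smul_sesq_mem_posCone x)
    have h₂ := hG _ (neg_I_smul_sesq_mem_posCone x)
    rw [map_neg] at h₂
    refine Eq.trans ?_ this.symm
    simp only [RCLike.I_to_complex]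
    linarith

theorem ext_re {E : Type*} [AddCommGroup E] [Module ℂ E] {P Q : E →ₗ[ℂ] ℂ}
    (h : ∀ u, (P u).re = (Q u).re) : P = Q := by
  ext u
  refine Complex.ext (h u) ?_
  simpa using h (Complex.I • u)

end CompletelyBounded
end

/-! ### The decomposition by Riesz extension -/

noncomputable section

open scoped ComplexOrder InnerProductSpace

namespace CompletelyBounded

open CStarMatrix

variable {ι A H : Type*} [CStarAlgebra A] [NormedAddCommGroup H] [InnerProductSpace ℂ H]

theorem form_add {n : Type*} [Fintype n] (φ : A →ₗ[ℂ] (H →L[ℂ] H))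
    (ξ : n → H) (M N : CStarMatrix n n A) :
    form φ ξ (M + N) = form φ ξ M + form φ ξ N := by
  simp [form, Finset.sum_add_distrib]

/-- The Gram functional `T ↦ ∑ Tᵢⱼ ⟪bᵢ, bⱼ⟫`. -/
def gram (b : ι → H) : ((ι × ι) →₀ ℂ) →ₗ[ℂ] ℂ :=
  functional b (LinearMap.id.smulRight (1 : H →L[ℂ] H))

variable [CompleteSpace H]

theorem form_star {n : Type*} [Fintype n] {φ : A →ₗ[ℂ] (H →L[ℂ] H)} (hφ : IsSelfAdjointMap φ)
    (ξ : n → H) (M : CStarMatrix n n A) :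
    form φ ξ (star M) = starRingEnd ℂ (form φ ξ M) := by
  simp only [form, map_sum, star_apply, hφ _, ContinuousLinearMap.star_eq_adjoint,
    ContinuousLinearMap.adjoint_inner_right, inner_conj_symm]
  exact Finset.sum_comm

variable [PartialOrder A] [StarOrderedRing A]

/-- Everything happens in a finite corner, where `norm_form_sub_le` applies to the hermitian parts;
both sides double. -/
theorem functional_sub_nonneg [Nontrivial A] (b : ι → H) {φ : A →ₗ[ℂ] (H →L[ℂ] H)}
    (hφ : IsSelfAdjointMap φ) {c : ℝ}
    (hc : ∀ (s : Finset ι) (M : CStarMatrix s s A), ‖M‖ ≤ 1 → ‖M.map φ‖ ≤ c)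
    {u v : (ι × ι) →₀ A} {T : (ι × ι) →₀ ℂ} (hu : u ∈ posCone ι A) (hv : v ∈ posCone ι A)
    (h : u + v = scalars ι A T) :
    0 ≤ c * (gram b T).re + (functional b φ (u - v)).re := by
  classical
  obtain ⟨s₁, h₁⟩ := exists_support_subset T
  obtain ⟨s₂, h₂⟩ := exists_support_subset (u - v)
  set s := s₁ ∪ s₂
  have h₁' : T.support ⊆ s ×ˢ s := h₁.trans (Finset.product_subset_product
    Finset.subset_union_left Finset.subset_union_left)
  have h₂' : (u - v).support ⊆ s ×ˢ s := h₂.trans (Finset.product_subset_product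
    Finset.subset_union_right Finset.subset_union_right)
  set ξ : s → H := fun i ↦ b i
  set T' := compress s T
  have hT : (compress s u + star (compress s u)) + (compress s v + star (compress s v)) =
      ofScalars s A (T' + star T') := by
    rw [add_add_add_comm, ← star_add, ← map_add, h, map_add, map_star]
    rfl
  have key := norm_form_sub_le (hc s) (hu s) (hv s) hT ξ
  have e₁ : ∑ i, ∑ j, (T' + star T') i j * ⟪ξ i, ξ j⟫_ℂ =
      gram b T + starRingEnd ℂ (gram b T) := by
    rw [gram, functional_eq_form b _ h₁']
    simp only [form, map_sum, CStarMatrix.add_apply, add_mul, Finset.sum_add_distrib]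
    congr 1
    · simp [T', ξ]
    · rw [Finset.sum_comm]
      simp [T', ξ, star_apply]
  have e₂ : form φ ξ (compress s u + star (compress s u) -
      (compress s v + star (compress s v))) =
      functional b φ (u - v) + starRingEnd ℂ (functional b φ (u - v)) := by
    rw [functional_eq_form b _ h₂', ← form_star hφ, ← form_add, map_sub, star_sub]
    congr 1
    abel
  rw [e₁, e₂] at key
  have := (neg_le_of_abs_le ((Complex.abs_re_le_norm _).trans key))
  simp only [Complex.add_re, Complex.conj_re] at this
  linarith

theorem exists_functional [Nontrivial A] (b : ι → H) {φ : A →ₗ[ℂ] (H →L[ℂ] H)}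
    (hφ : IsSelfAdjointMap φ) (h1 : φ 1 = 1) {c : ℝ}
    (hc : ∀ (s : Finset ι) (M : CStarMatrix s s A), ‖M‖ ≤ 1 → ‖M.map φ‖ ≤ c) :
    ∃ F : ((ι × ι) →₀ A) →ₗ[ℂ] ℂ, (∀ x, 0 ≤ F (sesq x x)) ∧
      (∀ x, 0 ≤ (F - (2 : ℂ) • functional b φ) (sesq x x)) ∧
      ∀ i j, F (Finsupp.single (i, j) 1) = ((c + 1 : ℝ) : ℂ) * ⟪b i, b j⟫_ℂ := by
  -- Any linear retraction onto the scalars will do: on `D` only its values at scalar matrices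
  -- matter.
  obtain ⟨lam, hlam⟩ := LinearMap.exists_leftInverse_of_injective (Algebra.linearMap ℂ A)
    (LinearMap.ker_eq_bot.2 (FaithfulSMul.algebraMap_injective ℂ A))
  set τ : ((ι × ι) →₀ A) →ₗ[ℂ] ℂ := gram b ∘ₗ Finsupp.mapRange.linearMap lam
  have hτ (T : (ι × ι) →₀ ℂ) : τ (scalars ι A T) = gram b T := by
    simp only [τ, scalars, LinearMap.comp_apply]
    congr 1
    ext p
    simpa using congr($hlam (T p))
  let P : ((ι × ι) →₀ A) × ((ι × ι) →₀ A) →ₗ[ℂ] ℂ := (c : ℂ) • (τ ∘ₗ (LinearMap.fst ℂ ((ι × ι) →₀ A) ((ι × ι) →₀ A) + LinearMap.snd ℂ ((ι × ι) →₀ A) ((ι × ι) →₀ A))) +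
    functional b φ ∘ₗ (LinearMap.fst ℂ ((ι × ι) →₀ A) ((ι × ι) →₀ A) - LinearMap.snd ℂ ((ι × ι) →₀ A) ((ι × ι) →₀ A))
  have hP (u v : ((ι × ι) →₀ A)) : P (u, v) = c * τ (u + v) + functional b φ (u - v) := rfl
  let f₀ : ((ι × ι) →₀ A) × ((ι × ι) →₀ A) →ₗ[ℝ] ℝ := Complex.reLm ∘ₗ P.restrictScalars ℝ
  have hf₀ (u v : ((ι × ι) →₀ A)) : f₀ (u, v) = c * (τ (u + v)).re + (functional b φ (u - v)).re := by
    change (P (u, v)).re = _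
    rw [hP]
    simp
  let D : Submodule ℝ (((ι × ι) →₀ A) × ((ι × ι) →₀ A)) :=
    ((LinearMap.range (scalars ι A)).comap
      (LinearMap.fst ℂ ((ι × ι) →₀ A) ((ι × ι) →₀ A) + LinearMap.snd ℂ ((ι × ι) →₀ A) ((ι × ι) →₀ A))).restrictScalars ℝ
  have hD (u v : ((ι × ι) →₀ A)) : (u, v) ∈ D ↔ ∃ T, scalars ι A T = u + v := Iff.rfl
  obtain ⟨g, hg, hpos⟩ := riesz_extension ((posCone ι A).prod (posCone ι A))
    ⟨D, f₀.domRestrict D⟩ (by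
      rintro ⟨⟨u, v⟩, hx⟩ ⟨hu, hv⟩
      obtain ⟨T, hT⟩ := (hD u v).1 hx
      change 0 ≤ f₀ (u, v)
      rw [hf₀, ← hT, hτ]
      exact functional_sub_nonneg b hφ hc hu hv hT.symm) (by
      rintro ⟨u, v⟩
      obtain ⟨S, hS⟩ := exists_scalars_add_mem_posCone u
      obtain ⟨T, hT⟩ := exists_scalars_add_mem_posCone v
      exact ⟨⟨(scalars ι A S, scalars ι A T), (hD _ _).2 ⟨S + T, map_add _ _ _⟩⟩, hS, hT⟩)
  have hg' (u v : ((ι × ι) →₀ A)) (T : (ι × ι) →₀ ℂ) (h : scalars ι A T = u + v) :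
      g (u, v) = c * (gram b T).re + (functional b φ (u - v)).re := by
    have := hg ⟨(u, v), (hD u v).2 ⟨T, h⟩⟩
    refine this.trans ((hf₀ u v).trans ?_)
    rw [← h, hτ]
  set G₁ : ((ι × ι) →₀ A) →ₗ[ℝ] ℝ := g ∘ₗ LinearMap.inl ℝ ((ι × ι) →₀ A) ((ι × ι) →₀ A)
  set G₂ : ((ι × ι) →₀ A) →ₗ[ℝ] ℝ := g ∘ₗ LinearMap.inr ℝ ((ι × ι) →₀ A) ((ι × ι) →₀ A)
  have hG₁ : ∀ u ∈ posCone ι A, 0 ≤ G₁ u := fun u hu ↦ hpos (u, 0) ⟨hu, zero_mem _⟩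
  have hG₂ : ∀ u ∈ posCone ι A, 0 ≤ G₂ u := fun u hu ↦ hpos (0, u) ⟨zero_mem _, hu⟩
  have hre (G : ((ι × ι) →₀ A) →ₗ[ℝ] ℝ) (u : ((ι × ι) →₀ A)) : (Module.Dual.extendRCLike (𝕜 := ℂ) G u).re = G u :=
    Module.Dual.re_extendRCLike_apply (𝕜 := ℂ) G u
  have hsub : Module.Dual.extendRCLike (𝕜 := ℂ) G₁ - (2 : ℂ) • functional b φ =
      Module.Dual.extendRCLike (𝕜 := ℂ) G₂ := by
    refine ext_re fun u ↦ ?_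
    -- The pair (u, -u) lies in `D` with T = 0, so g is prescribed there.
    have h₁ : g (u, -u) = 2 * (functional b φ u).re := by
      rw [hg' u (-u) 0 (by simp), sub_neg_eq_add, map_add, map_zero]
      simp
      ring
    have h₂ : g (u, -u) = G₁ u - G₂ u := by
      simp only [G₁, G₂, LinearMap.comp_apply, LinearMap.inl_apply, LinearMap.inr_apply,
        ← map_sub]
      simp
    rw [LinearMap.sub_apply, Complex.sub_re, hre, hre, LinearMap.smul_apply, smul_eq_mul]
    simp
    linarith
  refine ⟨Module.Dual.extendRCLike (𝕜 := ℂ) G₁, extendRCLike_sesq_nonneg G₁ hG₁, ?_, ?_⟩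
  · rw [hsub]
    exact extendRCLike_sesq_nonneg G₂ hG₂
  · intro i j
    -- The pair (T, 0) also lies in `D`. Since φ(1) = 1, the φ-term is one more copy of the Gram
    -- functional, whence c + 1.
    have h : Module.Dual.extendRCLike (𝕜 := ℂ) G₁ ∘ₗ scalars ι A =
        (c : ℂ) • gram b + functional b φ ∘ₗ scalars ι A := by
      refine ext_re fun T ↦ ?_
      rw [LinearMap.comp_apply, hre]
      refine (hg' _ 0 T (by simp)).trans ?_
      simp
    have hs : scalars ι A (Finsupp.single (i, j) 1) = Finsupp.single (i, j) 1 := by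
      simp [scalars]
    have := congr($h (Finsupp.single (i, j) 1))
    simp only [LinearMap.comp_apply, hs, LinearMap.add_apply,
      LinearMap.smul_apply, functional_single, h1, gram] at this
    rw [this]
    simp
    ring

end CompletelyBounded
end

/-! ### From positive functionals back to operator-valued maps -/

noncomputable section

open scoped ComplexOrder InnerProductSpace

theorem CStarAlgebra.exists_eq_star_mul_self {R : Type*} [CStarAlgebra R] [PartialOrder R]
    [StarOrderedRing R] {a : R} (ha : 0 ≤ a) : ∃ y, a = star y * y :=
  CStarAlgebra.nonneg_iff_eq_star_mul_self.1 ha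

namespace CompletelyBounded

open CStarMatrix

variable {ι A H : Type*} [CStarAlgebra A] [NormedAddCommGroup H] [InnerProductSpace ℂ H]

/-- The element `a ⊗ ξ` of `A ⊗ H`, in coordinates with respect to a basis of `H`. -/
def tens (b : Module.Basis ι ℂ H) : A →ₗ[ℂ] H →ₗ[ℂ] (ι →₀ A) :=
  LinearMap.mk₂ ℂ (fun a ξ ↦ (b.repr ξ).mapRange (fun z ↦ z • a) (zero_smul ℂ a))
    (fun a a' ξ ↦ by ext; simp) (fun c a ξ ↦ by ext; simp [smul_smul, mul_comm])
    (fun a ξ η ↦ by ext; simp [add_smul]) (fun c a ξ ↦ by ext; simp [smul_smul])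

@[simp]
theorem tens_apply (b : Module.Basis ι ℂ H) (a : A) (ξ : H) (i : ι) :
    tens b a ξ i = b.repr ξ i • a := rfl

theorem tens_basis (b : Module.Basis ι ℂ H) (a : A) (i : ι) :
    tens b a (b i) = Finsupp.single i a := by
  classical
  ext j
  simp [Finsupp.single_apply, ite_smul]

theorem sesq_tens (b : Module.Basis ι ℂ H) (a c : A) (ξ η : H) :
    sesq (tens b c ξ) (tens b a η) = sesq (tens b 1 ξ) (tens b (star c * a) η) := by
  ext p
  simp [smul_smul]

/-- The sesquilinear form `(ξ, η) ↦ F((c ⊗ ξ)⋆ (a ⊗ η))`. -/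
def tensForm (b : Module.Basis ι ℂ H) (F : ((ι × ι) →₀ A) →ₗ[ℂ] ℂ) (c a : A) :
    H →ₗ⋆[ℂ] H →ₗ[ℂ] ℂ :=
  LinearMap.mk₂'ₛₗ (starRingEnd ℂ) (RingHom.id ℂ) (fun ξ η ↦ F (sesq (tens b c ξ) (tens b a η)))
    (by simp) (by simp) (by simp) (by simp)

@[simp]
theorem tensForm_apply (b : Module.Basis ι ℂ H) (F : ((ι × ι) →₀ A) →ₗ[ℂ] ℂ) (c a : A)
    (ξ η : H) : tensForm b F c a ξ η = F (sesq (tens b c ξ) (tens b a η)) := rfl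

theorem apply_sesq_tens_one (b : Module.Basis ι ℂ H) {F : ((ι × ι) →₀ A) →ₗ[ℂ] ℂ} {k : ℝ}
    (hF : ∀ i j, F (Finsupp.single (i, j) 1) = (k : ℂ) * ⟪b i, b j⟫_ℂ) (ξ η : H) :
    F (sesq (tens b 1 ξ) (tens b 1 η)) = k * ⟪ξ, η⟫_ℂ := by
  have : tensForm b F 1 1 = (k : ℂ) • innerₛₗ ℂ := by
    refine b.ext fun i ↦ b.ext fun j ↦ ?_
    simp [tens_basis, sesq_single_single, hF]
  exact congr($this ξ η)

theorem functional_sesq_tens (b : Module.Basis ι ℂ H) (θ : A →ₗ[ℂ] (H →L[ℂ] H)) (c a : A)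
    (ξ η : H) : functional b θ (sesq (tens b c ξ) (tens b a η)) = ⟪ξ, θ (star c * a) η⟫_ℂ := by
  have : tensForm b (functional b θ) c a =
      (innerₛₗ ℂ).compl₂ (θ (star c * a)).toLinearMap := by
    refine b.ext fun i ↦ b.ext fun j ↦ ?_
    simp [tens_basis, sesq_single_single, -Finsupp.single_mul]
  exact congr($this ξ η)

/-- Polarization: F is real on the squares of x + y and x + iy. -/
theorem conj_apply_sesq {F : ((ι × ι) →₀ A) →ₗ[ℂ] ℂ} (hF : ∀ x, 0 ≤ F (sesq x x))
    (x y : ι →₀ A) : starRingEnd ℂ (F (sesq x y)) = F (sesq y x) := by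
  have him (z : ι →₀ A) : (F (sesq z z)).im = 0 := (Complex.nonneg_iff.1 (hF z)).2.symm
  have h₁ := him (x + y)
  have h₂ := him (x + Complex.I • y)
  simp only [map_add, LinearMap.add_apply, map_smulₛₗ, LinearMap.smul_apply, smul_eq_mul,
    RingHom.id_apply, Complex.conj_I, Complex.add_im, Complex.add_re, Complex.mul_im, Complex.neg_re,
    Complex.neg_im, Complex.I_re, Complex.I_im, Complex.mul_re, him] at h₁ h₂
  apply Complex.ext
  · simp only [Complex.conj_re]; linarith
  · simp only [Complex.conj_im]; linarith

theorem norm_apply_sesq_sq_le {F : ((ι × ι) →₀ A) →ₗ[ℂ] ℂ} (hF : ∀ x, 0 ≤ F (sesq x x))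
    (x y : ι →₀ A) : ‖F (sesq x y)‖ ^ 2 ≤ (F (sesq x x)).re * (F (sesq y y)).re := by
  let core : PreInnerProductSpace.Core ℂ (ι →₀ A) :=
    { inner := fun x y ↦ F (sesq x y)
      conj_inner_symm := fun x y ↦ conj_apply_sesq hF y x
      re_inner_nonneg := fun x ↦ (Complex.nonneg_iff.1 (hF x)).1
      add_left := by simp
      smul_left := by simp }
  have h : ‖F (sesq x y)‖ * ‖F (sesq y x)‖ ≤ (F (sesq x x)).re * (F (sesq y y)).re :=
    InnerProductSpace.Core.inner_mul_inner_self_le (c := core) x y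
  rwa [← conj_apply_sesq hF x y, RCLike.norm_conj, ← sq] at h

variable [PartialOrder A] [StarOrderedRing A]

/-- Cauchy–Schwarz for the semi-inner product defined by F, combined with a⋆a ≤ ‖a‖² as in the GNS
construction. -/
theorem norm_apply_sesq_tens_le (b : Module.Basis ι ℂ H) {F : ((ι × ι) →₀ A) →ₗ[ℂ] ℂ} {k : ℝ}
    (hk : 0 ≤ k) (hF : ∀ x, 0 ≤ F (sesq x x))
    (hF1 : ∀ i j, F (Finsupp.single (i, j) 1) = (k : ℂ) * ⟪b i, b j⟫_ℂ) (a : A) (ξ η : H) :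
    ‖F (sesq (tens b 1 ξ) (tens b a η))‖ ≤ k * ‖a‖ * ‖ξ‖ * ‖η‖ := by
  have hself (ζ : H) : (F (sesq (tens b 1 ζ) (tens b 1 ζ))).re = k * ‖ζ‖ ^ 2 := by
    rw [apply_sesq_tens_one b hF1, inner_self_eq_norm_sq_to_K]
    erw [← Complex.ofReal_pow]
    rw [← Complex.ofReal_mul, Complex.ofReal_re]
    rfl
  obtain ⟨d, hd⟩ : ∃ d : A, algebraMap ℝ A (‖a‖ ^ 2) - star a * a = star d * d :=
    CStarAlgebra.nonneg_iff_eq_star_mul_self.1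
      (sub_nonneg.2 CStarAlgebra.star_mul_le_algebraMap_norm_sq)
  have h₂ : (F (sesq (tens b a η) (tens b a η))).re ≤ ‖a‖ ^ 2 * (k * ‖η‖ ^ 2) := by
    have h := (Complex.nonneg_iff.1 (hF (tens b d η))).1
    have e : algebraMap ℝ A (‖a‖ ^ 2) = ((‖a‖ ^ 2 : ℝ) : ℂ) • (1 : A) := by
      rw [Algebra.algebraMap_eq_smul_one, Complex.coe_smul]
    rw [sesq_tens, ← hd, e, map_sub, map_smul, LinearMap.sub_apply, LinearMap.smul_apply, map_sub,
      map_smul, map_sub, map_smul, Complex.sub_re, smul_eq_mul, Complex.re_ofReal_mul, hself] at h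
    rw [sesq_tens]
    linarith
  refine le_of_sq_le_sq ?_ (by positivity)
  calc _ ≤ _ := norm_apply_sesq_sq_le hF _ _
    _ ≤ (k * ‖ξ‖ ^ 2) * (‖a‖ ^ 2 * (k * ‖η‖ ^ 2)) := by
      rw [hself]
      gcongr
    _ = _ := by ring

variable [CompleteSpace H]

theorem exists_eq_functional (b : Module.Basis ι ℂ H) {F : ((ι × ι) →₀ A) →ₗ[ℂ] ℂ} {k : ℝ}
    (hk : 0 ≤ k) (hF : ∀ x, 0 ≤ F (sesq x x))
    (hF1 : ∀ i j, F (Finsupp.single (i, j) 1) = (k : ℂ) * ⟪b i, b j⟫_ℂ) :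
    ∃ Φ : A →ₗ[ℂ] (H →L[ℂ] H), F = functional b Φ ∧ Φ 1 = (k : ℂ) • 1 := by
  let B (a : A) : H →L⋆[ℂ] H →L[ℂ] ℂ := LinearMap.mkContinuous₂ (tensForm b F 1 a) (k * ‖a‖)
    fun ξ η ↦ norm_apply_sesq_tens_le b hk hF hF1 a ξ η
  -- The representing operator of `B a` acts in the left slot of the inner product; the adjoint
  -- moves it to the right.
  let Φ (a : A) : H →L[ℂ] H := star (InnerProductSpace.continuousLinearMapOfBilin (B a))
  have hΦ (a : A) (ξ η : H) : ⟪ξ, Φ a η⟫_ℂ = F (sesq (tens b 1 ξ) (tens b a η)) := by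
    simp only [Φ]
    rw [ContinuousLinearMap.star_eq_adjoint, ContinuousLinearMap.adjoint_inner_right,
      InnerProductSpace.continuousLinearMapOfBilin_apply]
    rfl
  refine ⟨{ toFun := Φ, map_add' := fun a a' ↦ ?_, map_smul' := fun c a ↦ ?_ }, ?_, ?_⟩
  · ext η
    refine ext_inner_left ℂ fun ξ ↦ ?_
    simp [inner_add_right, hΦ]
  · ext η
    refine ext_inner_left ℂ fun ξ ↦ ?_
    simp [inner_smul_right, hΦ]
  · refine Finsupp.lhom_ext fun p a ↦ ?_
    rw [functional_single]
    refine Eq.trans ?_ (hΦ a _ _).symm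
    simp [tens_basis, sesq_single_single]
  · ext η
    refine ext_inner_left ℂ fun ξ ↦ (hΦ 1 ξ η).trans ?_
    rw [apply_sesq_tens_one b hF1]
    simp

/-- Writing M = R⋆R, each row k of R contributes the functional at the square of ∑ᵢ Rₖᵢ ⊗ ξᵢ. -/
theorem map_nonneg_of_functional_nonneg (b : Module.Basis ι ℂ H) {θ : A →ₗ[ℂ] (H →L[ℂ] H)}
    (hθ : ∀ x, 0 ≤ functional b θ (sesq x x)) {n : Type*} [Fintype n] {M : CStarMatrix n n A}
    (hM : 0 ≤ M) : 0 ≤ M.map θ := by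
  classical
  obtain ⟨R, rfl⟩ := CStarAlgebra.exists_eq_star_mul_self hM
  rw [nonneg_iff_inner]
  intro ξ
  have : ∑ i, ∑ j, ⟪ξ i, (star R * R).map θ i j (ξ j)⟫_ℂ =
      ∑ k, functional b θ (sesq (∑ i, tens b (R k i) (ξ i)) (∑ i, tens b (R k i) (ξ i))) := by
    simp only [map_sum, LinearMap.sum_apply, functional_sesq_tens, CStarMatrix.map_apply, mul_apply,
      star_apply, _root_.sum_apply, inner_sum]
    calc _ = ∑ i, ∑ k, ∑ j, ⟪ξ i, θ (star (R k i) * R k j) (ξ j)⟫_ℂ :=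
          Finset.sum_congr rfl fun i _ ↦ Finset.sum_comm
      _ = ∑ k, ∑ i, ∑ j, ⟪ξ i, θ (star (R k i) * R k j) (ξ j)⟫_ℂ := Finset.sum_comm
      _ = _ := Finset.sum_congr rfl fun k _ ↦ Finset.sum_comm
  rw [this]
  exact Finset.sum_nonneg fun k _ ↦ hθ _

end CompletelyBounded
end

/-! ### Assembling the unital completely positive map -/

noncomputable section

open scoped ComplexOrder InnerProductSpace

namespace CompletelyBounded

open CStarMatrix

variable {ι A H : Type*} [CStarAlgebra A] [NormedAddCommGroup H] [InnerProductSpace ℂ H]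

theorem functional_smul (b : ι → H) (c : ℂ) (θ : A →ₗ[ℂ] (H →L[ℂ] H)) :
    functional b (c • θ) = c • functional b θ := by
  refine Finsupp.lhom_ext fun p a ↦ ?_
  simp

theorem functional_sub (b : ι → H) (θ η : A →ₗ[ℂ] (H →L[ℂ] H)) :
    functional b (θ - η) = functional b θ - functional b η := by
  refine Finsupp.lhom_ext fun p a ↦ ?_
  simp

variable [PartialOrder A] [StarOrderedRing A] [CompleteSpace H]

/-- `cbNorm` only sees index types `Fin n`, while the corners are indexed by finite sets of basis
indices; reindexing is isometric. -/
theorem norm_map_le_of_cbNorm_le {φ : A →ₗ[ℂ] (H →L[ℂ] H)} {c : ℝ} (hc : 0 ≤ c)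
    (hφ : cbNorm φ ≤ ENNReal.ofReal c) {n : Type*} [Fintype n] (M : CStarMatrix n n A)
    (hM : ‖M‖ ≤ 1) : ‖M.map φ‖ ≤ c := by
  let e := Fintype.equivFin n
  let M' := reindexₐ ℂ A e M
  have hM' : ‖M'‖ ≤ 1 := by
    rwa [NonUnitalStarAlgHom.norm_map (reindexₐ ℂ A e) (reindexₐ ℂ A e).injective]
  have h : ‖M'.map φ‖ₑ ≤ ENNReal.ofReal c :=
    (le_iSup₂_of_le (f := fun (M : CStarMatrix _ _ A) (_ : ‖M‖ ≤ 1) ↦ ‖M.map φ‖ₑ) M' hM'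
      le_rfl).trans ((le_iSup (ampNorm φ) _).trans hφ)
  rw [← ofReal_norm, ENNReal.ofReal_le_ofReal_iff hc] at h
  have e₁ : M'.map φ = reindexₐ ℂ (H →L[ℂ] H) e (M.map φ) := rfl
  rwa [e₁, NonUnitalStarAlgHom.norm_map (reindexₐ ℂ (H →L[ℂ] H) e)
    (reindexₐ ℂ (H →L[ℂ] H) e).injective] at h

theorem cbNorm_le {φ : A →ₗ[ℂ] (H →L[ℂ] H)} {c : ℝ}
    (h : ∀ (n : ℕ) (M : CStarMatrix (Fin n) (Fin n) A), ‖M‖ ≤ 1 → ‖M.map φ‖ ≤ c) :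
    cbNorm φ ≤ ENNReal.ofReal c :=
  iSup_le fun n ↦ iSup₂_le fun M hM ↦ by
    rw [← ofReal_norm]
    exact ENNReal.ofReal_le_ofReal (h n M hM)

/-- A self-adjoint unital map with `‖φ‖_cb ≤ 1 + ε` is within `ε` of a unital completely positive
map. -/
theorem exists_completelyPositive [Nontrivial A] {ε : ℝ} (hε : 0 ≤ ε)
    {φ : A →ₗ[ℂ] (H →L[ℂ] H)} (hφ : IsSelfAdjointMap φ) (h1 : φ 1 = 1)
    (hcb : cbNorm φ ≤ ENNReal.ofReal (1 + ε)) :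
    ∃ ψ : A →CP (H →L[ℂ] H), ψ 1 = 1 ∧ cbNorm (φ - ψ.toLinearMap) ≤ ENNReal.ofReal ε := by
  let b := Module.Basis.ofVectorSpace ℂ H
  obtain ⟨F, hF, hF₂, hF1⟩ := exists_functional b hφ h1
    fun s M hM ↦ norm_map_le_of_cbNorm_le (by positivity) hcb M hM
  obtain ⟨Φ, rfl, hΦ1⟩ := exists_eq_functional b (by positivity) hF hF1
  have hk : ((1 + ε + 1 : ℝ) : ℂ) ≠ 0 := Complex.ofReal_ne_zero.2 (by positivity)
  let ψ : A →CP (H →L[ℂ] H) :=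
    { (((1 + ε + 1)⁻¹ : ℝ) : ℂ) • Φ with
      map_cstarMatrix_nonneg' := fun k M hM ↦ map_nonneg_of_functional_nonneg b (fun x ↦ by
        rw [functional_smul]
        exact mul_nonneg (Complex.zero_le_real.2 (by positivity)) (hF x)) hM }
  -- Half of the second map Φ - 2φ; its value at 1 is ((2 + ε) - 2)/2 = ε/2.
  let θ : A →CP (H →L[ℂ] H) :=
    { ((1 / 2 : ℝ) : ℂ) • (Φ - (2 : ℂ) • φ) with
      map_cstarMatrix_nonneg' := fun k M hM ↦ map_nonneg_of_functional_nonneg b (fun x ↦ by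
        rw [functional_smul, functional_sub, functional_smul]
        exact mul_nonneg (Complex.zero_le_real.2 (by positivity)) (hF₂ x)) hM }
  have hψ (a : A) : ψ a = (((1 + ε + 1)⁻¹ : ℝ) : ℂ) • Φ a := rfl
  have hθ (a : A) : θ a = ((1 / 2 : ℝ) : ℂ) • (Φ a - (2 : ℂ) • φ a) := rfl
  have hψ1 : ψ 1 = 1 := by
    rw [hψ, hΦ1, smul_smul, Complex.ofReal_inv, inv_mul_cancel₀ hk, one_smul]
  have hθ1 : θ 1 = ((ε / 2 : ℝ) : ℂ) • 1 := by
    rw [hθ, hΦ1, h1, ← sub_smul, smul_smul]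
    congr 1
    push_cast
    ring
  refine ⟨ψ, hψ1, cbNorm_le fun n M hM ↦ ?_⟩
  -- This is φ = (1 + ε/2)ψ - θ, applied entrywise.
  have e : M.map (φ - ψ.toLinearMap) = ((ε / 2 : ℝ) : ℂ) • M.map ψ - M.map θ := by
    ext1 i j
    have e₁ : M.map (φ - ψ.toLinearMap) i j = φ (M i j) - ψ (M i j) := rfl
    rw [e₁, CStarMatrix.sub_apply, CStarMatrix.smul_apply, CStarMatrix.map_apply,
      CStarMatrix.map_apply, hθ, hψ]
    push_cast at hk ⊢
    match_scalars <;> field_simp <;> ring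
  rw [e]
  have hψn := ψ.norm_map_le zero_le_one (by simpa using hψ1) hM
  have hθn := θ.norm_map_le (by positivity) hθ1 hM
  calc _ ≤ ‖((ε / 2 : ℝ) : ℂ) • M.map ψ‖ + ‖M.map θ‖ := norm_sub_le _ _
    _ ≤ ε / 2 * 1 + ε / 2 := by
      rw [norm_smul, Complex.norm_real, Real.norm_of_nonneg (by positivity)]
      gcongr
    _ = ε := by ring

end CompletelyBounded
end

/-! ### The main theorem -/

theorem mainTheorem8 {A : Type*} [CStarAlgebra A] [PartialOrder A] [StarOrderedRing A]
    {H : Type*} [NormedAddCommGroup H] [InnerProductSpace ℂ H] [CompleteSpace H]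
    (ε : ℝ) (hε₀ : 0 ≤ ε) (hε₁ : ε < 1)
    (φ : A →ₗ[ℂ] (H →L[ℂ] H))
    (hφ_selfAdjoint : CompletelyBounded.IsSelfAdjointMap φ)
    (hφ_unital : φ 1 = 1)
    (hφ_cb : CompletelyBounded.IsCompletelyBounded φ)
    (hφ_norm : CompletelyBounded.cbNorm φ ≤ ENNReal.ofReal (1 + ε)) :
    ∃ ψ : A →CP (H →L[ℂ] H), ψ 1 = 1 ∧
      CompletelyBounded.cbNorm (φ - ψ.toLinearMap) ≤ ENNReal.ofReal (3 * √ε) := by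
  rcases subsingleton_or_nontrivial A with hA | hA
  -- If A = 0, unitality of φ forces 1 = 0 in B(H), so the zero map is unital.
  · have h0 : (1 : H →L[ℂ] H) = 0 := by
      rw [← hφ_unital, Subsingleton.elim (1 : A) 0, map_zero]
    refine ⟨{ (0 : A →ₗ[ℂ] (H →L[ℂ] H)) with
      map_cstarMatrix_nonneg' := fun k M _ ↦
        (CStarMatrix.ext fun _ _ ↦ rfl : (0 : CStarMatrix _ _ (H →L[ℂ] H)) = _).le }, h0.symm, ?_⟩
    refine CompletelyBounded.cbNorm_le fun n M _ ↦ ?_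
    refine (norm_le_zero_iff.2 (CStarMatrix.ext fun i j ↦ ?_)).trans (by positivity)
    rw [CStarMatrix.map_apply, Subsingleton.elim (M i j) 0, map_zero]
    rfl
  · obtain ⟨ψ, hψ1, hψ⟩ := CompletelyBounded.exists_completelyPositive hε₀ hφ_selfAdjoint
      hφ_unital hφ_norm
    refine ⟨ψ, hψ1, hψ.trans (ENNReal.ofReal_le_ofReal ?_)⟩
    -- Since √ε ≤ 1, ε = √ε·√ε ≤ √ε ≤ 3√ε.
    nlinarith [Real.sq_sqrt hε₀, Real.sqrt_nonneg ε, Real.sqrt_le_one.2 hε₁.le]
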